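/- **Conventions.** Let $\Lambda$ be the real Banach algebra of supernumbers $z=\sum_I z_I\zeta^I$, where $\zeta^1,\zeta^2,\dots$ are countably many anticommuting generators, $I$ runs over the finite increasing multi-indices, $z_I\in\mathbb R$, and $\|z\|=\sum_I|z_I|<\infty$. Write $\Lambda^0,\Lambda^1$ for the even and odd parts, $\beta(z)=z_\emptyset\in\mathbb R$ for the body and $s(z)=z-\beta(z)$ for the soul. Let $M$ be a $G^\infty$ supermanifold of dimension $(m,n)$, modelled on $\mathbb R^{m|n}=(\Lambda^0)^m\times(\Lambda^1)^n$; a map is $G^\infty$ if it is $C^\infty$ with $\Lambda^0$-linear derivative. The tangent space $T_qM$ is the $\mathbb Z_2$-graded $\Lambda$-module of superderivations, at $q$, of germs of $G^\infty$ functions. A super Riemannian metric $g$ on $M$ is a $G^\infty$ family of even, biadditive, left $\Lambda$-linear (in the first argument), supersymmetric ($g(X,Y)=(-1)^{|X||Y|}g(Y,X)$), nondegenerate maps $g_q:T_qM\times T_qM\to\Lambda$. A pure basis of $T_qM$ is a $\Lambda$-basis consisting of even vectors $e_1,\dots,e_m$ and odd vectors $f_\alpha$; a pure frame on an open set is a family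 of super vector fields that is a pure basis at each point. Let $\mathcal J$ be the standard symplectic matrix, block diagonal with $l$ blocks $J=\begin{pmatrix}0&1\\-1&0\end{pmatrix}$. **Theorem.** Let $g$ be a super Riemannian metric on $M$, let $p\in M$, and let $\{\bar e_i,\bar f_\alpha\}$ be a pure frame on an open neighbourhood $U$ of $p$ relative to which the matrix of $g$ at each point of $U$ is $$\begin{pmatrix}\operatorname{diag}(d_1,\dots,d_m)&0\\0&\mathcal J\end{pmatrix},\qquad d_i=g(\bar e_i,\bar e_i)\ \text{ invertible in }\Lambda^0 .$$ 1. Suppose that $\dfrac{\|s(d_i)\|}{|\beta(d_i)|}<1$ at $p$ for every $i$. Then there are an open set $V$ with $p\in V\subseteq U$, on which these inequalities still hold, and $G^\infty$ functions $\lambda_i:V\to\Lambda^0$, given by the convergent series $$\lambda_i=\frac1{\sqrt{|\beta(d_i)|}}\sum_{k\ge0}\binom{-1/2}{k}\Big(\frac{s(d_i)}{\beta(d_i)}\Big)^k ,$$ such that, with $\hat e_i=\lambda_i\bar e_i$, the family $\{\hat e_i,\bar f_\alpha\}$ is a pure frame on $V$ relative to which the matrix of $g$ at every point of $V$ is $$\Gamma_g=\begin{pmatrix}\eta&0\\0&\mathcal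 J\end{pmatrix},\qquad \eta=\operatorname{diag}(\pm1,\dots,\pm1),$$ with signs that are constant on $V$; that is, $\Gamma_g$ is a generalized orthosymplectic matrix. 2. Whether or not the condition in (1) holds, there are real numbers $c_i>0$ such that $\tilde e_i=c_i\,\bar e_i(p)$, together with the $\bar f_\alpha(p)$, form a pure basis of $T_pM$ relative to which $g_p$ has the matrix $\begin{pmatrix}\operatorname{diag}(\tilde d_i)&0\\0&\mathcal J\end{pmatrix}$ with $\|\tilde d_i\|=1$ for all $i$; and, for each $i$, $\|s(d_i(p))\|/|\beta(d_i(p))|<1$ if and only if $\|s(\tilde d_i)\|<\frac12$. 3. For every pure basis $\{\tilde e_i,\tilde f_\alpha\}$ of $T_pM$ such that $\tilde d_i=g(\tilde e_i,\tilde e_i)$ satisfies $\|\tilde d_i\|=1$ for all $i$, and for each $i$: $\beta(\tilde d_i)\ne0$ and $\|s(\tilde d_i)\|/|\beta(\tilde d_i)|<1$ if and only if $\|s(\tilde d_i)\|<\frac12$. -/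

import Mathlib

open Filter Topology Set
open scoped ContDiff Manifold

noncomputable section

/-- The Banach space `ℓ₁` of absolutely summable families of real numbers indexed by the increasing
multi-indices, i.e. by the finite subsets `I` of `ℕ`: the family `z` stands for the series
`∑ z_I ζ^I` in the anticommuting generators `ζ^0, ζ^1, …`, and `‖z‖ = ∑ |z_I|`. -/
def Supernumber : Type := lp (fun _ : Finset ℕ => ℝ) 1

namespace Supernumber

instance : NormedAddCommGroup Supernumber :=
  inferInstanceAs (NormedAddCommGroup (lp (fun _ : Finset ℕ => ℝ) 1))

instance : NormedSpace ℝ Supernumber :=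
  inferInstanceAs (NormedSpace ℝ (lp (fun _ : Finset ℕ => ℝ) 1))

instance : CompleteSpace Supernumber :=
  inferInstanceAs (CompleteSpace (lp (fun _ : Finset ℕ => ℝ) 1))

/-- The coefficient `z_I`. -/
def coeff (z : Supernumber) (I : Finset ℕ) : ℝ := Subtype.val z I

@[ext] theorem ext {a b : Supernumber} (h : ∀ I, a.coeff I = b.coeff I) : a = b :=
  Subtype.ext (funext h)

@[simp] theorem coeff_add (a b : Supernumber) (I : Finset ℕ) :
    (a + b).coeff I = a.coeff I + b.coeff I := rfl

@[simp] theorem coeff_zero (I : Finset ℕ) : (0 : Supernumber).coeff I = 0 := rfl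

@[simp] theorem coeff_neg (a : Supernumber) (I : Finset ℕ) : (-a).coeff I = -a.coeff I := rfl

@[simp] theorem coeff_sub (a b : Supernumber) (I : Finset ℕ) :
    (a - b).coeff I = a.coeff I - b.coeff I := rfl

@[simp] theorem coeff_smul (r : ℝ) (a : Supernumber) (I : Finset ℕ) :
    (r • a).coeff I = r * a.coeff I := rfl

theorem summable_abs_coeff (a : Supernumber) : Summable fun I => |a.coeff I| := by
  have h := (memℓp_gen_iff (E := fun _ : Finset ℕ => ℝ) (p := 1) (by simp)).1 (Subtype.property a)
  simp only [ENNReal.toReal_one, Real.rpow_one] at h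
  exact h

theorem norm_eq (a : Supernumber) : ‖a‖ = ∑' I, |a.coeff I| := by
  have h := lp.norm_eq_tsum_rpow (E := fun _ : Finset ℕ => ℝ) (p := 1) (by simp) a
  simp only [ENNReal.toReal_one, Real.rpow_one, div_one] at h
  exact h

/-- The supernumber with a given absolutely summable family of coefficients. -/
def ofCoeff (f : Finset ℕ → ℝ) (hf : Summable fun I => |f I|) : Supernumber :=
  (⟨f, (memℓp_gen_iff (E := fun _ : Finset ℕ => ℝ) (p := 1) (by simp)).2 (by simpa using hf)⟩ :
    lp (fun _ : Finset ℕ => ℝ) 1)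

@[simp] theorem coeff_ofCoeff (f : Finset ℕ → ℝ) (hf : Summable fun I => |f I|) (I : Finset ℕ) :
    (ofCoeff f hf).coeff I = f I := rfl

/-- The sign with `ζ^I ζ^J = sign I J • ζ^(I ∪ J)` for disjoint `I`, `J`:
minus one to the number of pairs in `I × J` that are out of order. -/
def sign (I J : Finset ℕ) : ℝ := (-1) ^ ((I ×ˢ J).filter fun x => x.2 < x.1).card

theorem abs_sign (I J : Finset ℕ) : |sign I J| = 1 := by
  simp [sign, abs_pow]

theorem sign_empty_left (J : Finset ℕ) : sign ∅ J = 1 := by simp [sign]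

theorem sign_empty_right (J : Finset ℕ) : sign J ∅ = 1 := by simp [sign]

theorem sign_union_left {I J : Finset ℕ} (h : Disjoint I J) (K : Finset ℕ) :
    sign (I ∪ J) K = sign I K * sign J K := by
  rw [sign, sign, sign, ← pow_add, Finset.union_product, Finset.filter_union,
    Finset.card_union_of_disjoint]
  exact Finset.disjoint_filter_filter (Finset.disjoint_product.2 (Or.inl h))

theorem sign_union_right (I : Finset ℕ) {J K : Finset ℕ} (h : Disjoint J K) :
    sign I (J ∪ K) = sign I J * sign I K := by
  rw [sign, sign, sign, ← pow_add, Finset.product_union, Finset.filter_union,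
    Finset.card_union_of_disjoint]
  exact Finset.disjoint_filter_filter (Finset.disjoint_product.2 (Or.inr h))

theorem summable_pairs (a b : Supernumber) :
    Summable fun x : (K : Finset ℕ) × {I // I ∈ K.powerset} =>
      |a.coeff x.2.1| * |b.coeff (x.1 \ x.2.1)| := by
  have h : Summable fun y : Finset ℕ × Finset ℕ => |a.coeff y.1| * |b.coeff y.2| :=
    a.summable_abs_coeff.mul_of_nonneg b.summable_abs_coeff
      (fun _ => abs_nonneg _) (fun _ => abs_nonneg _)
  refine h.comp_injective (i := fun x : (K : Finset ℕ) × {I // I ∈ K.powerset} =>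
    ((x.2.1, x.1 \ x.2.1) : Finset ℕ × Finset ℕ)) ?_
  rintro ⟨K, I, hI⟩ ⟨K', I', hI'⟩ hx
  simp only [Prod.mk.injEq] at hx
  obtain ⟨rfl, h2⟩ := hx
  have : K = K' := by
    rw [← Finset.union_sdiff_of_subset (Finset.mem_powerset.1 hI), h2,
      Finset.union_sdiff_of_subset (Finset.mem_powerset.1 hI')]
  subst this
  rfl

theorem tsum_pairs_le (a b : Supernumber) :
    ∑' x : (K : Finset ℕ) × {I // I ∈ K.powerset},
      |a.coeff x.2.1| * |b.coeff (x.1 \ x.2.1)| ≤ ‖a‖ * ‖b‖ := by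
  have h : Summable fun y : Finset ℕ × Finset ℕ => |a.coeff y.1| * |b.coeff y.2| :=
    a.summable_abs_coeff.mul_of_nonneg b.summable_abs_coeff
      (fun _ => abs_nonneg _) (fun _ => abs_nonneg _)
  rw [norm_eq, norm_eq, a.summable_abs_coeff.tsum_mul_tsum b.summable_abs_coeff h]
  refine (summable_pairs a b).tsum_le_tsum_of_inj
    (fun x : (K : Finset ℕ) × {I // I ∈ K.powerset} =>
      ((x.2.1, x.1 \ x.2.1) : Finset ℕ × Finset ℕ)) ?_ (fun _ _ => by positivity)
    (fun _ => le_rfl) h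
  rintro ⟨K, I, hI⟩ ⟨K', I', hI'⟩ hx
  simp only [Prod.mk.injEq] at hx
  obtain ⟨rfl, h2⟩ := hx
  have : K = K' := by
    rw [← Finset.union_sdiff_of_subset (Finset.mem_powerset.1 hI), h2,
      Finset.union_sdiff_of_subset (Finset.mem_powerset.1 hI')]
  subst this
  rfl

/-- The coefficients of the product `a b`. -/
def mulCoeff (a b : Supernumber) (K : Finset ℕ) : ℝ :=
  ∑ I ∈ K.powerset, sign I (K \ I) * (a.coeff I * b.coeff (K \ I))

theorem abs_mulCoeff_le (a b : Supernumber) (K : Finset ℕ) :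
    |mulCoeff a b K| ≤ ∑' I : {I // I ∈ K.powerset}, |a.coeff I.1| * |b.coeff (K \ I.1)| := by
  rw [tsum_fintype, Finset.sum_coe_sort K.powerset fun I => |a.coeff I| * |b.coeff (K \ I)|]
  refine (Finset.abs_sum_le_sum_abs _ _).trans (Finset.sum_le_sum fun I _ => ?_)
  rw [abs_mul, abs_sign, one_mul, abs_mul]

theorem summable_mulCoeff (a b : Supernumber) : Summable fun K => |mulCoeff a b K| :=
  Summable.of_nonneg_of_le (fun _ => abs_nonneg _) (abs_mulCoeff_le a b)
    (summable_pairs a b).sigma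

/-- The product `(∑ a_I ζ^I) (∑ b_J ζ^J)`. -/
instance : Mul Supernumber := ⟨fun a b => ofCoeff (mulCoeff a b) (summable_mulCoeff a b)⟩

theorem coeff_mul (a b : Supernumber) (K : Finset ℕ) :
    (a * b).coeff K = ∑ I ∈ K.powerset, sign I (K \ I) * (a.coeff I * b.coeff (K \ I)) := rfl

theorem norm_mul_le' (a b : Supernumber) : ‖a * b‖ ≤ ‖a‖ * ‖b‖ := by
  refine le_trans ?_ (tsum_pairs_le a b)
  rw [norm_eq, (summable_pairs a b).tsum_sigma]
  exact (summable_mulCoeff a b).tsum_le_tsum (abs_mulCoeff_le a b) (summable_pairs a b).sigma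

instance : One Supernumber :=
  ⟨ofCoeff (fun I => if I = ∅ then 1 else 0)
    (summable_of_ne_finset_zero (s := {∅}) fun I hI => by simp_all)⟩

theorem coeff_one (I : Finset ℕ) : (1 : Supernumber).coeff I = if I = ∅ then 1 else 0 := rfl

protected theorem one_mul (a : Supernumber) : 1 * a = a := by
  ext K
  rw [coeff_mul, Finset.sum_eq_single ∅]
  · simp [coeff_one, sign_empty_left]
  · intro I _ hI; simp [coeff_one, hI]
  · simp

protected theorem mul_one (a : Supernumber) : a * 1 = a := by
  ext K
  rw [coeff_mul, Finset.sum_eq_single K]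
  · simp [coeff_one, sign_empty_right]
  · intro I hI hne
    have : K \ I ≠ ∅ := fun h =>
      hne ((Finset.mem_powerset.1 hI).antisymm (Finset.sdiff_eq_empty_iff_subset.1 h))
    simp [coeff_one, this]
  · simp

protected theorem mul_assoc (a b c : Supernumber) : a * b * c = a * (b * c) := by
  ext K
  simp only [coeff_mul, Finset.mul_sum, Finset.sum_mul]
  rw [Finset.sum_sigma', Finset.sum_sigma']
  refine Finset.sum_bij' (fun x _ => ⟨x.2, x.1 \ x.2⟩) (fun y _ => ⟨y.1 ∪ y.2, y.1⟩) ?_ ?_ ?_ ?_ ?_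
  · rintro ⟨L, I⟩ h
    simp only [Finset.mem_sigma, Finset.mem_powerset] at h ⊢
    exact ⟨h.2.trans h.1, Finset.sdiff_subset_sdiff h.1 le_rfl⟩
  · rintro ⟨I, J⟩ h
    simp only [Finset.mem_sigma, Finset.mem_powerset] at h ⊢
    exact ⟨Finset.union_subset h.1 (h.2.trans Finset.sdiff_subset), Finset.subset_union_left⟩
  · rintro ⟨L, I⟩ h
    simp only [Finset.mem_sigma, Finset.mem_powerset] at h
    simp [Finset.union_sdiff_of_subset h.2]
  · rintro ⟨I, J⟩ h
    simp only [Finset.mem_sigma, Finset.mem_powerset] at h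
    have hd : Disjoint J I := Finset.disjoint_of_subset_left h.2 Finset.sdiff_disjoint
    simp [Finset.union_sdiff_left, Finset.sdiff_eq_self_of_disjoint hd]
  · rintro ⟨L, I⟩ h
    simp only [Finset.mem_sigma, Finset.mem_powerset] at h
    obtain ⟨hL, hI⟩ := h
    have e1 : (K \ I) \ (L \ I) = K \ L := by
      ext x; simp only [Finset.mem_sdiff]; have := @hI x; tauto
    have e2 : K \ I = (L \ I) ∪ (K \ L) := by
      ext x; simp only [Finset.mem_sdiff, Finset.mem_union]
      have := @hI x; have := @hL x; tauto
    have d2 : Disjoint (L \ I) (K \ L) :=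
      Finset.disjoint_of_subset_left Finset.sdiff_subset Finset.disjoint_sdiff
    have s1 : sign L (K \ L) = sign I (K \ L) * sign (L \ I) (K \ L) := by
      have h := sign_union_left (Finset.disjoint_sdiff (s := I) (t := L)) (K \ L)
      rwa [Finset.union_sdiff_of_subset hI] at h
    have s2 : sign I (K \ I) = sign I (L \ I) * sign I (K \ L) := by
      rw [e2]; exact sign_union_right _ d2
    simp only [e1, s1, s2]
    ring

instance : Ring Supernumber :=
  { (inferInstance : AddCommGroup Supernumber) with
    mul := (· * ·)
    one := 1
    mul_assoc := Supernumber.mul_assoc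
    one_mul := Supernumber.one_mul
    mul_one := Supernumber.mul_one
    zero_mul := fun a => by ext K; simp [coeff_mul]
    mul_zero := fun a => by ext K; simp [coeff_mul]
    left_distrib := fun a b c => by
      ext K; simp [coeff_mul, mul_add, Finset.sum_add_distrib]
    right_distrib := fun a b c => by
      ext K; simp [coeff_mul, add_mul, mul_add, Finset.sum_add_distrib] }

instance : NormedRing Supernumber :=
  { (inferInstance : NormedAddCommGroup Supernumber), (inferInstance : Ring Supernumber) with
    norm_mul_le := norm_mul_le' }

instance : Algebra ℝ Supernumber :=
  Algebra.ofModule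
    (fun r a b => by
      ext K; simp only [coeff_mul, coeff_smul, Finset.mul_sum]
      exact Finset.sum_congr rfl fun _ _ => by ring)
    (fun r a b => by
      ext K; simp only [coeff_mul, coeff_smul, Finset.mul_sum]
      exact Finset.sum_congr rfl fun _ _ => by ring)

instance : NormedAlgebra ℝ Supernumber :=
  { (inferInstance : Algebra ℝ Supernumber) with norm_smul_le := norm_smul_le }

/-- The body `β(z) = z_∅`. -/
def body (z : Supernumber) : ℝ := z.coeff ∅

/-- The soul `s(z) = z - β(z)`. -/
def soul (z : Supernumber) : Supernumber := z - algebraMap ℝ Supernumber z.body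

/-- `z` is homogeneous of parity `ε`: only the `ζ^I` with `|I| ≡ ε` modulo two occur in `z`. -/
def HasParity (ε : ZMod 2) (z : Supernumber) : Prop := ∀ I, z.coeff I ≠ 0 → (I.card : ZMod 2) = ε

theorem HasParity.mul {ε δ : ZMod 2} {a b : Supernumber} (ha : HasParity ε a)
    (hb : HasParity δ b) : HasParity (ε + δ) (a * b) := by
  intro K hK
  rw [coeff_mul] at hK
  obtain ⟨I, hI, hne⟩ := Finset.exists_ne_zero_of_sum_ne_zero hK
  have h1 := ha I (by intro h; simp [h] at hne)
  have h2 := hb (K \ I) (by intro h; simp [h] at hne)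
  rw [← h1, ← h2, ← Nat.cast_add, add_comm,
    Finset.card_sdiff_add_card_eq_card (Finset.mem_powerset.1 hI)]

theorem HasParity.add {ε : ZMod 2} {a b : Supernumber} (ha : HasParity ε a)
    (hb : HasParity ε b) : HasParity ε (a + b) := by
  intro K hK
  by_cases h : a.coeff K = 0
  · exact hb K (by simpa [h] using hK)
  · exact ha K h

theorem hasParity_zero (ε : ZMod 2) : HasParity ε 0 := fun _ h => absurd rfl h

theorem hasParity_algebraMap (r : ℝ) : HasParity 0 (algebraMap ℝ Supernumber r) := by
  intro K hK
  rw [Algebra.algebraMap_eq_smul_one, coeff_smul, coeff_one] at hK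
  by_cases h : K = ∅
  · simp [h]
  · simp [h] at hK

theorem sign_mul_sign {I J : Finset ℕ} (h : Disjoint I J) :
    sign I J * sign J I = (-1) ^ (I.card * J.card) := by
  have h1 : ((J ×ˢ I).filter fun x => x.2 < x.1).card
      = ((I ×ˢ J).filter fun x => ¬ x.2 < x.1).card := by
    refine Finset.card_bij' (fun x _ => x.swap) (fun x _ => x.swap) ?_ ?_ ?_ ?_
    · rintro ⟨i, j⟩ hx
      simp only [Finset.mem_filter, Finset.mem_product, Prod.swap] at hx ⊢
      exact ⟨⟨hx.1.2, hx.1.1⟩, by omega⟩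
    · rintro ⟨i, j⟩ hx
      simp only [Finset.mem_filter, Finset.mem_product, Prod.swap] at hx ⊢
      have hne : i ≠ j := fun e => Finset.disjoint_left.1 h hx.1.1 (e ▸ hx.1.2)
      exact ⟨⟨hx.1.2, hx.1.1⟩, by omega⟩
    · intro _ _; rfl
    · intro _ _; rfl
  rw [sign, sign, h1, ← pow_add, Finset.card_filter_add_card_filter_not, Finset.card_product]

theorem HasParity.comm {a : Supernumber} (ha : HasParity 0 a) (b : Supernumber) :
    a * b = b * a := by
  ext K
  rw [coeff_mul, coeff_mul]
  refine Finset.sum_bij' (fun I _ => K \ I) (fun I _ => K \ I) ?_ ?_ ?_ ?_ ?_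
  · intro I _; simp
  · intro I _; simp
  · intro I hI; exact Finset.sdiff_sdiff_eq_self (Finset.mem_powerset.1 hI)
  · intro I hI; exact Finset.sdiff_sdiff_eq_self (Finset.mem_powerset.1 hI)
  · intro I hI
    rw [Finset.sdiff_sdiff_eq_self (Finset.mem_powerset.1 hI)]
    by_cases h0 : a.coeff I = 0
    · simp [h0]
    · have he : (-1 : ℝ) ^ (I.card * (K \ I).card) = 1 :=
        (((ZMod.natCast_eq_zero_iff_even).1 (ha I h0)).mul_right _).neg_one_pow
      have hs := sign_mul_sign (Finset.disjoint_sdiff (s := I) (t := K))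
      have hq : sign (K \ I) I * sign (K \ I) I = 1 := by
        rw [← abs_mul_abs_self, abs_sign, _root_.one_mul]
      have : sign I (K \ I) = sign (K \ I) I := by
        calc sign I (K \ I) = sign I (K \ I) * (sign (K \ I) I * sign (K \ I) I) := by
              rw [hq, _root_.mul_one]
          _ = sign (K \ I) I := by rw [← _root_.mul_assoc, hs, he, _root_.one_mul]
      rw [this]; ring

/-- The algebra `Λ⁰` of even supernumbers. -/
def EvenPart : Subalgebra ℝ Supernumber where
  carrier := {z | HasParity 0 z}
  mul_mem' := fun ha hb => by simpa using HasParity.mul ha hb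
  add_mem' := fun ha hb => HasParity.add ha hb
  algebraMap_mem' := hasParity_algebraMap

/-- The `Λ⁰`-module `Λ¹` of odd supernumbers. -/
def OddPart : Submodule EvenPart Supernumber where
  carrier := {z | HasParity 1 z}
  add_mem' := fun ha hb => HasParity.add ha hb
  zero_mem' := hasParity_zero 1
  smul_mem' := fun c _ hx => zero_add (1 : ZMod 2) ▸ HasParity.mul c.2 hx

end Supernumber

open Supernumber

/-- The superspace `ℝ^{m|n} = (Λ⁰)^m × (Λ¹)^n`. Its norm is equivalent to the sum of the norms
of the components, so that it gives the same topology and the same differentiable maps. -/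
abbrev SuperSpace (m n : ℕ) : Type := (Fin m → EvenPart) × (Fin n → OddPart)

/-- A map `f` between superspaces (or from a superspace to the supernumbers) is `G^∞` on the open
set `s` if it is smooth on `s` and superdifferentiable at each point of `s`, i.e. its Fréchet
derivative there is linear over the even supernumbers. -/
structure IsGInfty {E F : Type*} [NormedAddCommGroup E] [NormedSpace ℝ E] [SMul EvenPart E]
    [NormedAddCommGroup F] [NormedSpace ℝ F] [SMul EvenPart F] (f : E → F) (s : Set E) : Prop where
  contDiffOn : ContDiffOn ℝ ∞ f s
  fderiv_smul : ∀ x ∈ s, ∀ (a : EvenPart) (v : E), fderiv ℝ f x (a • v) = a • fderiv ℝ f x v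

theorem IsGInfty.congr {E F : Type*} [NormedAddCommGroup E] [NormedSpace ℝ E] [SMul EvenPart E]
    [NormedAddCommGroup F] [NormedSpace ℝ F] [SMul EvenPart F] {f g : E → F} {s : Set E}
    (hs : IsOpen s) (h : ∀ x ∈ s, g x = f x) (hf : IsGInfty f s) : IsGInfty g s where
  contDiffOn := hf.contDiffOn.congr h
  fderiv_smul x hx a v := by
    have : g =ᶠ[𝓝 x] f := by filter_upwards [hs.mem_nhds hx] with y hy using h y hy
    rw [this.fderiv_eq]
    exact hf.fderiv_smul x hx a v

theorem IsGInfty.differentiableAt {E F : Type*} [NormedAddCommGroup E] [NormedSpace ℝ E]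
    [SMul EvenPart E] [NormedAddCommGroup F] [NormedSpace ℝ F] [SMul EvenPart F] {f : E → F} {s : Set E}
    (hs : IsOpen s) (hf : IsGInfty f s) {x : E} (hx : x ∈ s) : DifferentiableAt ℝ f x :=
  (hf.contDiffOn.contDiffAt (hs.mem_nhds hx)).differentiableAt (by simp)

theorem IsGInfty.mono {E F : Type*} [NormedAddCommGroup E] [NormedSpace ℝ E] [SMul EvenPart E]
    [NormedAddCommGroup F] [NormedSpace ℝ F] [SMul EvenPart F] {f : E → F} {s t : Set E}
    (hf : IsGInfty f s) (h : t ⊆ s) : IsGInfty f t where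
  contDiffOn := hf.contDiffOn.mono h
  fderiv_smul x hx := hf.fderiv_smul x (h hx)

/-- The pregroupoid of `G^∞` maps on open subsets of `ℝ^{m|n}`. -/
def gInftyPregroupoid (m n : ℕ) : Pregroupoid (SuperSpace m n) where
  property f s := IsGInfty f s
  comp {f g u v} hf hg hu hv huv :=
    { contDiffOn := hg.contDiffOn.comp (hf.contDiffOn.mono inter_subset_left) fun x hx => hx.2
      fderiv_smul := fun x hx a w => by
        rw [fderiv_comp x (hg.differentiableAt hv hx.2) (hf.differentiableAt hu hx.1)]
        simp only [ContinuousLinearMap.comp_apply]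
        rw [hf.fderiv_smul x hx.1, hg.fderiv_smul _ hx.2] }
  id_mem :=
    { contDiffOn := contDiffOn_id
      fderiv_smul := fun x _ a v => by simp }
  locality {f u} hu h :=
    { contDiffOn := contDiffOn_of_locally_contDiffOn fun x hx =>
        let ⟨v, hv, hxv, hf⟩ := h x hx
        ⟨v, hv, hxv, hf.contDiffOn⟩
      fderiv_smul := fun x hx =>
        let ⟨_, _, hxv, hf⟩ := h x hx
        hf.fderiv_smul x ⟨hx, hxv⟩ }
  congr hu h hf := hf.congr hu h

/-- The groupoid of `G^∞` coordinate changes. A `G^∞` supermanifold of dimension `(m, n)` is a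
space `M` with `[ChartedSpace (SuperSpace m n) M]` and `[HasGroupoid M (gInftyGroupoid m n)]`. -/
def gInftyGroupoid (m n : ℕ) : StructureGroupoid (SuperSpace m n) :=
  (gInftyPregroupoid m n).groupoid

theorem IsGInfty.mul {E : Type*} [NormedAddCommGroup E] [NormedSpace ℝ E] [SMul EvenPart E]
    {f g : E → Supernumber} {s : Set E} (hs : IsOpen s)
    (hf : IsGInfty f s) (hg : IsGInfty g s) : IsGInfty (fun x => f x * g x) s where
  contDiffOn := hf.contDiffOn.mul hg.contDiffOn
  fderiv_smul x hx a v := by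
    have h1 := (hf.differentiableAt hs hx).hasFDerivAt.mul' (hg.differentiableAt hs hx).hasFDerivAt
    have h4 : fderiv ℝ (fun x => f x * g x) x = _ := h1.fderiv
    rw [h4]
    have h2 : ∀ w : Supernumber, f x * (a • w) = a • (f x * w) := fun w => by
      change f x * ((a : Supernumber) * w) = (a : Supernumber) * (f x * w)
      rw [← mul_assoc, ← mul_assoc, HasParity.comm a.2]
    have h3 : ∀ w : Supernumber, (a • w) * g x = a • (w * g x) := fun w =>
      mul_assoc (a : Supernumber) w (g x)
    simp only [add_apply, smul_apply,
      hf.fderiv_smul x hx, hg.fderiv_smul x hx, smul_eq_mul, MulOpposite.smul_eq_mul_unop,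
      MulOpposite.unop_op, h2, h3, smul_add]

theorem IsGInfty.add {E : Type*} [NormedAddCommGroup E] [NormedSpace ℝ E] [SMul EvenPart E]
    {f g : E → Supernumber} {s : Set E} (hs : IsOpen s)
    (hf : IsGInfty f s) (hg : IsGInfty g s) : IsGInfty (fun x => f x + g x) s where
  contDiffOn := hf.contDiffOn.add hg.contDiffOn
  fderiv_smul x hx a v := by
    rw [fderiv_fun_add (hf.differentiableAt hs hx) (hg.differentiableAt hs hx)]
    simp [hf.fderiv_smul x hx, hg.fderiv_smul x hx, smul_add]

theorem isGInfty_const {E : Type*} [NormedAddCommGroup E] [NormedSpace ℝ E] [SMul EvenPart E]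
    (c : Supernumber) (s : Set E) : IsGInfty (fun _ : E => c) s where
  contDiffOn := contDiffOn_const
  fderiv_smul x hx a v := by simp

instance {X : Type*} (l : Filter X) : Algebra ℝ (Germ l Supernumber) :=
  Algebra.ofModule
    (fun r F G => Germ.inductionOn₂ F G fun f g =>
      congrArg (Germ.ofFun (l := l)) (smul_mul_assoc r f g))
    (fun r F G => Germ.inductionOn₂ F G fun f g =>
      congrArg (Germ.ofFun (l := l)) (mul_smul_comm r f g))

section Supermanifold

variable (m n : ℕ) {M : Type*} [TopologicalSpace M] [ChartedSpace (SuperSpace m n) M]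

/-- The supernumber-valued function `f` is `G^∞` on the open set `U` of `M`. -/
def IsGInftyOn (f : M → Supernumber) (U : Set M) : Prop :=
  ∀ φ ∈ atlas (SuperSpace m n) M, IsGInfty (f ∘ φ.symm) (φ.target ∩ φ.symm ⁻¹' U)

variable {m n}

theorem IsGInftyOn.mono {f : M → Supernumber} {U V : Set M} (hf : IsGInftyOn m n f U)
    (h : V ⊆ U) : IsGInftyOn m n f V := fun φ hφ =>
  (hf φ hφ).mono (inter_subset_inter_right _ (preimage_mono h))

variable (m n)

/-- The algebra of germs at `p` of `G^∞` functions. -/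
def GInftyGerm (p : M) : Subalgebra ℝ (Germ (𝓝 p) Supernumber) where
  carrier := {F | ∃ U : Set M, IsOpen U ∧ p ∈ U ∧
    ∃ f : M → Supernumber, IsGInftyOn m n f U ∧ F = (f : Germ (𝓝 p) Supernumber)}
  mul_mem' := by
    rintro _ _ ⟨U, hU, hpU, f, hf, rfl⟩ ⟨V, hV, hpV, g, hg, rfl⟩
    exact ⟨U ∩ V, hU.inter hV, ⟨hpU, hpV⟩, f * g, fun φ hφ =>
      IsGInfty.mul (φ.isOpen_inter_preimage_symm (hU.inter hV))
        (hf.mono inter_subset_left φ hφ) (hg.mono inter_subset_right φ hφ), rfl⟩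
  add_mem' := by
    rintro _ _ ⟨U, hU, hpU, f, hf, rfl⟩ ⟨V, hV, hpV, g, hg, rfl⟩
    exact ⟨U ∩ V, hU.inter hV, ⟨hpU, hpV⟩, f + g, fun φ hφ =>
      IsGInfty.add (φ.isOpen_inter_preimage_symm (hU.inter hV))
        (hf.mono inter_subset_left φ hφ) (hg.mono inter_subset_right φ hφ), rfl⟩
  algebraMap_mem' r :=
    ⟨univ, isOpen_univ, mem_univ p, fun _ => r • (1 : Supernumber),
      fun _ _ => isGInfty_const _ _, rfl⟩

/-- `X` is a homogeneous tangent vector of parity `ε` at `p`: it maps germs of parity `δ` to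
supernumbers of parity `ε + δ`, it vanishes on constants, and it satisfies the graded Leibniz rule
`X(FG) = X(F) G(p) + (-1)^(|X||F|) F(p) X(G)`. -/
structure IsSuperderivation (p : M) (ε : ZMod 2) (X : GInftyGerm m n p →ₗ[ℝ] Supernumber) :
    Prop where
  hasParity : ∀ (δ : ZMod 2) (F : GInftyGerm m n p),
    Germ.LiftPred (HasParity δ) F.1 → HasParity (ε + δ) (X F)
  map_const : ∀ (F : GInftyGerm m n p) (c : Supernumber),
    F.1 = ((fun _ => c : M → Supernumber) : Germ (𝓝 p) Supernumber) → X F = 0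
  leibniz : ∀ (δ : ZMod 2) (F G : GInftyGerm m n p), Germ.LiftPred (HasParity δ) F.1 →
    X (F * G) = X F * G.1.value + (-1) ^ (ε.val * δ.val) * (F.1.value * X G)

/-- The tangent space `T_p M`: the left `Λ`-module generated by the homogeneous tangent vectors.
Every element of it is the sum of an even and an odd tangent vector. -/
def superTangentSubmodule (p : M) :
    Submodule Supernumber (GInftyGerm m n p →ₗ[ℝ] Supernumber) :=
  Submodule.span Supernumber {X | ∃ ε, IsSuperderivation m n p ε X}

/-- The tangent space `T_p M` as a type. -/
abbrev SuperTangent (p : M) : Type _ := superTangentSubmodule m n p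

variable {m n}

/-- `X(f)` for a tangent vector `X` at `p` and a function `f` that is `G^∞` near `p`
(the value is irrelevant, and set to zero, for other functions). -/
def SuperTangent.apply {p : M} (X : SuperTangent m n p) (f : M → Supernumber) : Supernumber :=
  open Classical in
  if h : (f : Germ (𝓝 p) Supernumber) ∈ GInftyGerm m n p then X.1 ⟨f, h⟩ else 0

/-- `X` is homogeneous of parity `ε`. -/
def SuperTangent.HasParity {p : M} (ε : ZMod 2) (X : SuperTangent m n p) : Prop :=
  IsSuperderivation m n p ε X.1

/-- `X` is a super vector field on the open set `U`: for each `G^∞` function `f` on an open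
`V ⊆ U`, the function `q ↦ X(q)(f)` is `G^∞` on `V`. The values of `X` off `U` are irrelevant. -/
def IsSuperVectorField (X : ∀ q : M, SuperTangent m n q) (U : Set M) : Prop :=
  ∀ V ⊆ U, IsOpen V → ∀ f : M → Supernumber, IsGInftyOn m n f V →
    IsGInftyOn m n (fun q => (X q).apply f) V

variable (m n M)

/-- Super Riemannian metrics on a supermanifold of dimension `(m, n)`. -/
structure SuperRiemannianMetric where
  /-- the value `g_p(X, Y)` -/
  toFun : ∀ p : M, SuperTangent m n p → SuperTangent m n p → Supernumber
  add_left : ∀ (p : M) (X Y Z : SuperTangent m n p), toFun p (X + Y) Z = toFun p X Z + toFun p Y Z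
  add_right : ∀ (p : M) (X Y Z : SuperTangent m n p), toFun p X (Y + Z) = toFun p X Y + toFun p X Z
  smul_left : ∀ (p : M) (a : Supernumber) (X Y : SuperTangent m n p),
    toFun p (a • X) Y = a * toFun p X Y
  supersymmetric : ∀ (p : M) (ε δ : ZMod 2) (X Y : SuperTangent m n p),
    X.HasParity ε → Y.HasParity δ → toFun p X Y = (-1) ^ (ε.val * δ.val) * toFun p Y X
  nondegenerate : ∀ (p : M) (Z : SuperTangent m n p), (∀ X, toFun p X Z = 0) ↔ Z = 0
  even : ∀ (p : M) (ε δ : ZMod 2) (X Y : SuperTangent m n p),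
    X.HasParity ε → Y.HasParity δ → HasParity (ε + δ) (toFun p X Y)
  smooth : ∀ (U : Set M), IsOpen U → ∀ X Y : ∀ q : M, SuperTangent m n q,
    IsSuperVectorField X U → IsSuperVectorField Y U →
      IsGInftyOn m n (fun q => toFun q (X q) (Y q)) U

variable {m n M}

/-- The even vectors `e` and the odd vectors `f` form together a basis of the `Λ`-module `T_p M`.
Equivalently, each even vector is in exactly one way of the form `∑ x^i e_i + ∑ θ^α f_α` with
`x^i` in `Λ⁰` and `θ^α` in `Λ¹`, and each odd one with `x^i` in `Λ¹` and `θ^α` in `Λ⁰`. -/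
structure IsPureBasis {p : M} {ι κ : Type*} (e : ι → SuperTangent m n p)
    (f : κ → SuperTangent m n p) : Prop where
  even : ∀ i, (e i).HasParity 0
  odd : ∀ α, (f α).HasParity 1
  linearIndependent : LinearIndependent Supernumber (Sum.elim e f)
  span_eq_top : Submodule.span Supernumber (range (Sum.elim e f)) = ⊤

/-- The vector fields `e` and `f` on the open set `U` form a pure basis at each point of `U`. -/
structure IsPureFrameOn {ι κ : Type*} (e : ι → ∀ q : M, SuperTangent m n q)
    (f : κ → ∀ q : M, SuperTangent m n q) (U : Set M) : Prop where
  isSuperVectorField_even : ∀ i, IsSuperVectorField (e i) U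
  isSuperVectorField_odd : ∀ α, IsSuperVectorField (f α) U
  isPureBasis : ∀ q ∈ U, IsPureBasis (fun i => e i q) (fun α => f α q)

/-- The matrix `Γ_g` of `g_p` relative to the vectors `e`, `f`. -/
def SuperRiemannianMetric.gram (g : SuperRiemannianMetric m n M) {p : M} {ι κ : Type*}
    (e : ι → SuperTangent m n p) (f : κ → SuperTangent m n p) :
    Matrix (ι ⊕ κ) (ι ⊕ κ) Supernumber :=
  Matrix.of fun a b => g.toFun p (Sum.elim e f a) (Sum.elim e f b)

end Supermanifold

/-- The standard symplectic matrix, with `l` diagonal blocks `J = (0 1; -1 0)`; the index `(r, k)`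
is the `r`-th index of the `k`-th block. -/
def standardSymplectic (l : ℕ) : Matrix (Fin 2 × Fin l) (Fin 2 × Fin l) Supernumber :=
  Matrix.blockDiagonal fun _ => !![0, 1; -1, 0]

/-- The block matrix with blocks `η = diag(d_1, …, d_m)` and the standard symplectic matrix. -/
def canonicalMatrix {m : ℕ} (l : ℕ) (d : Fin m → Supernumber) :
    Matrix (Fin m ⊕ Fin 2 × Fin l) (Fin m ⊕ Fin 2 × Fin l) Supernumber :=
  Matrix.fromBlocks (Matrix.diagonal d) 0 0 (standardSymplectic l)

/-- The condition `‖s(d)‖ / |β(d)| < 1`, which presupposes `β(d) ≠ 0`. -/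
def SoulBodyRatioLtOne (d : Supernumber) : Prop :=
  d.body ≠ 0 ∧ ‖d.soul‖ / |d.body| < 1

/-- `lam = |β(d)|^(-1/2) (1 + μ)^(-1/2)` with `μ = s(d) / β(d)`, where the last factor is the sum of
the binomial series `∑ₖ choose(-1/2, k) μ^k`. -/
def IsBinomialScaling (d lam : Supernumber) : Prop :=
  HasSum (fun k : ℕ => ((√|d.body|)⁻¹ * Ring.choose (-1 / 2 : ℝ) k) • (d.body⁻¹ • d.soul) ^ k) lam

end

/-! Everything rests on a square root in the Banach algebra `Λ`. If `‖s(d)‖ < |β(d)|`, write `d =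
β(d)(1 + μ)` with `μ = s(d)/β(d)` and `‖μ‖ < 1`. The binomial series for `(1 + μ)^(-1/2)` converges
absolutely, and its square times `1 + μ` is `1` (`binomialSum_neg_half_mul_self_mul`). Hence `λ =
|β(d)|^(-1/2) (1 + μ)^(-1/2)` satisfies `λ² d = sign β(d)` (`binomialScaling_mul_self_mul`).

For even `d` the sum `λ` is even, hence central, and the identity makes it a unit. It can therefore
be pulled out of both slots of `g`, and rescaling `e_i` by `λ_i` turns `d_i` into `λ_i² d_i = ±1`
without disturbing the zero entries or the odd block. The ratio condition is open, and the sign is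
constant wherever the body keeps the sign it has at `p`.

Smoothness of `λ` follows from analyticity of the series. The `Λ⁰`-linearity of its derivative is
read off from the relation instead of the series: differentiating `λ² d = const` gives `2 λ d Dλ =
-λ² Dd`, and `λ d` is a unit (`IsGInfty.binomialScaling`).

The normalization statements come from the `ℓ₁` identity `‖d‖ = |β(d)| + ‖s(d)‖`: if `‖d‖ = 1`, then
`‖s(d)‖ < |β(d)|` says exactly `‖s(d)‖ < 1/2`. Real rescaling does not change the ratio. -/

/-! ### The binomial series in a Banach algebra. -/

section BinomialSeries

variable {A : Type*} [NormedRing A] [NormedAlgebra ℝ A]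

/-- The sum `(1 + x)^a` of the binomial series in a Banach algebra, for `‖x‖ < 1`. -/
noncomputable def binomialSum (a : ℝ) (x : A) : A := (binomialSeries A a).sum x

theorem binomialSum_eq_tsum (a : ℝ) (x : A) :
    binomialSum a x = ∑' k : ℕ, Ring.choose a k • x ^ k := by
  simp [binomialSum, FormalMultilinearSeries.sum]

theorem binomialSum_zero (x : A) : binomialSum 0 x = 1 := by
  rw [binomialSum_eq_tsum, tsum_eq_single 0]
  · simp
  · intro k hk
    simp [Ring.choose_zero_ite, hk]

theorem binomialSum_one (x : A) : binomialSum 1 x = 1 + x := by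
  have h : ∀ k : ℕ, Ring.choose (1 : ℝ) k = Nat.choose 1 k := fun k => by
    simpa using Ring.choose_natCast (R := ℝ) 1 k
  rw [binomialSum_eq_tsum, tsum_eq_sum (s := Finset.range 2)]
  · simp [Finset.sum_range_succ, h]
  · intro k hk
    rw [h, Nat.choose_eq_zero_of_lt (by simpa using hk)]
    simp

variable [NormOneClass A]

/-- In an algebra with `‖1‖ = 1` the `n`-th term has operator norm `|choose(a, n)|`, the same as
over `ℝ`, so the bounds for the real series carry over. -/
theorem one_le_radius_binomialSeries (a : ℝ) : 1 ≤ (binomialSeries A a).radius := by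
  have hn : ∀ n, ‖binomialSeries A a n‖ ≤ ‖binomialSeries ℝ a n‖ := fun n =>
    (FormalMultilinearSeries.ofScalars_norm (E := A) (Ring.choose a ·) n).trans_le
      (FormalMultilinearSeries.ofScalars_norm (E := ℝ) (Ring.choose a ·) n).ge
  refine ENNReal.le_of_forall_nnreal_lt fun r hr => ?_
  have hr' : (r : ENNReal) < (binomialSeries ℝ a).radius :=
    hr.trans_le binomialSeries_radius_ge_one
  obtain ⟨C, -, hC⟩ := (binomialSeries ℝ a).norm_mul_pow_le_of_lt_radius hr'
  exact (binomialSeries A a).le_radius_of_bound C fun n =>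
    (mul_le_mul_of_nonneg_right (hn n) (by positivity)).trans (hC n)

theorem summable_norm_choose_smul_pow (a : ℝ) {x : A} (hx : ‖x‖ < 1) :
    Summable fun k : ℕ => ‖Ring.choose a k • x ^ k‖ := by
  have h1 : ((‖x‖₊ : NNReal) : ENNReal) < (binomialSeries ℝ a).radius :=
    lt_of_lt_of_le (by exact_mod_cast hx) binomialSeries_radius_ge_one
  refine Summable.of_nonneg_of_le (fun _ => norm_nonneg _) (fun k => ?_)
    ((binomialSeries ℝ a).summable_norm_mul_pow h1)
  rw [binomialSeries, FormalMultilinearSeries.ofScalars_norm, norm_smul]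
  exact mul_le_mul_of_nonneg_left (norm_pow_le x k) (norm_nonneg _)

variable [CompleteSpace A]

theorem hasSum_binomialSum (a : ℝ) {x : A} (hx : ‖x‖ < 1) :
    HasSum (fun k : ℕ => Ring.choose a k • x ^ k) (binomialSum a x) := by
  rw [binomialSum_eq_tsum]
  exact (summable_norm_choose_smul_pow a hx).of_norm.hasSum

theorem contDiffAt_binomialSum (a : ℝ) {x : A} (hx : ‖x‖ < 1) :
    ContDiffAt ℝ ∞ (binomialSum a : A → A) x := by
  have hr := one_le_radius_binomialSeries (A := A) a
  have h := (binomialSeries A a).hasFPowerSeriesOnBall (zero_lt_one.trans_le hr)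
  refine (h.analyticAt_of_mem ?_).contDiffAt
  rw [Metric.mem_eball, edist_zero_right]
  exact lt_of_lt_of_le (by rw [enorm_eq_nnnorm]; exact_mod_cast hx) hr

/-- The Cauchy product of the two absolutely convergent series, with coefficients collected by the
Chu–Vandermonde identity. Only powers of one `x` are multiplied, so `A` need not be commutative. -/
theorem binomialSum_add (a b : ℝ) {x : A} (hx : ‖x‖ < 1) :
    binomialSum (a + b) x = binomialSum a x * binomialSum b x := by
  simp only [binomialSum_eq_tsum]
  rw [tsum_mul_tsum_eq_tsum_sum_antidiagonal_of_summable_norm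
    (summable_norm_choose_smul_pow a hx) (summable_norm_choose_smul_pow b hx)]
  refine tsum_congr fun k => ?_
  rw [Ring.add_choose_eq k (Commute.all a b), Finset.sum_smul]
  refine Finset.sum_congr rfl fun ij hij => ?_
  rw [smul_mul_smul_comm, ← pow_add, Finset.HasAntidiagonal.mem_antidiagonal.1 hij]

/-- Exponents add, and `-1/2 - 1/2 + 1 = 0`. -/
theorem binomialSum_neg_half_mul_self_mul {x : A} (hx : ‖x‖ < 1) :
    binomialSum (-1 / 2) x * binomialSum (-1 / 2) x * (1 + x) = 1 := by
  rw [← binomialSum_one, ← binomialSum_add _ _ hx, ← binomialSum_add _ _ hx]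
  norm_num [binomialSum_zero]

end BinomialSeries

/-! ### Body, soul, and the scaling of a single supernumber. -/

namespace Supernumber

instance : NormOneClass Supernumber where
  norm_one := by
    rw [norm_eq, tsum_eq_single ∅]
    · simp [coeff_one]
    · intro I hI
      simp [coeff_one, hI]

instance : Nontrivial Supernumber := NormOneClass.nontrivial

theorem abs_coeff_le_norm (z : Supernumber) (I : Finset ℕ) : |z.coeff I| ≤ ‖z‖ := by
  rw [norm_eq]
  exact z.summable_abs_coeff.le_tsum I fun _ _ => abs_nonneg _

/-- The coefficient `z_I` as a continuous linear functional of `z`. -/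
noncomputable def coeffCLM (I : Finset ℕ) : Supernumber →L[ℝ] ℝ :=
  LinearMap.mkContinuous
    { toFun := fun z => z.coeff I
      map_add' := fun _ _ => rfl
      map_smul' := fun _ _ => rfl } 1 fun z => by
    rw [one_mul]
    exact abs_coeff_le_norm z I

@[simp] theorem coeffCLM_apply (I : Finset ℕ) (z : Supernumber) : coeffCLM I z = z.coeff I := rfl

theorem continuous_body : Continuous body := (coeffCLM ∅).continuous

theorem contDiff_body : ContDiff ℝ ∞ body := (coeffCLM ∅).contDiff

theorem contDiff_soul : ContDiff ℝ ∞ soul :=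
  contDiff_id.sub ((Algebra.linearMap ℝ Supernumber).mkContinuous 1 (fun r => by
    simp [norm_algebraMap']) |>.contDiff.comp contDiff_body)

theorem coeff_algebraMap (r : ℝ) (I : Finset ℕ) :
    (algebraMap ℝ Supernumber r).coeff I = if I = ∅ then r else 0 := by
  rw [Algebra.algebraMap_eq_smul_one, coeff_smul, coeff_one]
  simp

theorem coeff_soul (z : Supernumber) (I : Finset ℕ) :
    z.soul.coeff I = if I = ∅ then 0 else z.coeff I := by
  rw [soul, coeff_sub, coeff_algebraMap]
  split_ifs with h <;> simp [h, body]

/-- The `ℓ₁` norm splits off the term `I = ∅`. This is the source of the threshold `1/2`. -/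
theorem norm_eq_abs_body_add_norm_soul (z : Supernumber) : ‖z‖ = |z.body| + ‖z.soul‖ := by
  rw [norm_eq, norm_eq, z.summable_abs_coeff.tsum_eq_add_tsum_ite ∅]
  simp only [coeff_soul, body]
  congr 1
  refine tsum_congr fun I => ?_
  split_ifs <;> simp

theorem body_smul (r : ℝ) (z : Supernumber) : (r • z).body = r * z.body := rfl

theorem soul_smul (r : ℝ) (z : Supernumber) : (r • z).soul = r • z.soul := by
  ext I
  simp only [coeff_soul, coeff_smul]
  split_ifs <;> simp

theorem body_smul_add_soul (z : Supernumber) : z.body • (1 : Supernumber) + z.soul = z := by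
  rw [soul, Algebra.algebraMap_eq_smul_one, add_sub_cancel]

/-- Parity is the vanishing of certain coefficients, and each coefficient is a continuous linear
functional. -/
theorem hasParity_of_hasSum {ι : Type*} {ε : ZMod 2} {f : ι → Supernumber} {z : Supernumber}
    (h : HasSum f z) (hf : ∀ i, HasParity ε (f i)) : HasParity ε z := by
  intro I hI
  by_contra hne
  refine hI ((h.mapL (coeffCLM I)).unique ?_)
  have : (fun i => coeffCLM I (f i)) = fun _ => 0 := funext fun i => by
    by_contra h0
    exact hne (hf i I h0)
  rw [this]
  exact hasSum_zero

theorem HasParity.smul {ε : ZMod 2} {z : Supernumber} (r : ℝ) (hz : HasParity ε z) :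
    HasParity ε (r • z) := fun I hI => hz I fun h => hI (by simp [h])

theorem HasParity.soul {ε : ZMod 2} {z : Supernumber} (hz : HasParity ε z) :
    HasParity ε z.soul := fun I hI => hz I fun h => hI (by simp [coeff_soul, h])

/-- The strict inequality already forces a nonzero body. In this division-free form the condition is
visibly open. -/
theorem soulBodyRatioLtOne_iff (d : Supernumber) :
    SoulBodyRatioLtOne d ↔ ‖d.soul‖ < |d.body| := by
  constructor
  · rintro ⟨h0, h⟩
    rwa [div_lt_one (abs_pos.2 h0)] at h
  · intro h
    have h0 : 0 < |d.body| := (norm_nonneg _).trans_lt h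
    exact ⟨abs_pos.1 h0, (div_lt_one h0).2 h⟩

theorem isOpen_soulBodyRatioLtOne : IsOpen {d : Supernumber | SoulBodyRatioLtOne d} := by
  simp only [soulBodyRatioLtOne_iff]
  exact isOpen_lt contDiff_soul.continuous.norm continuous_body.abs

theorem soulBodyRatioLtOne_iff_of_norm_eq_one {d : Supernumber} (hd : ‖d‖ = 1) :
    SoulBodyRatioLtOne d ↔ ‖d.soul‖ < 1 / 2 := by
  rw [norm_eq_abs_body_add_norm_soul] at hd
  rw [soulBodyRatioLtOne_iff]
  constructor <;> intro h <;> linarith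

theorem soulBodyRatioLtOne_smul {r : ℝ} (hr : r ≠ 0) (d : Supernumber) :
    SoulBodyRatioLtOne (r • d) ↔ SoulBodyRatioLtOne d := by
  rw [soulBodyRatioLtOne_iff, soulBodyRatioLtOne_iff, soul_smul, body_smul, norm_smul, abs_mul,
    Real.norm_eq_abs, mul_lt_mul_iff_right₀ (abs_pos.2 hr)]

theorem norm_inv_body_smul_soul_lt_one {d : Supernumber} (hd : SoulBodyRatioLtOne d) :
    ‖d.body⁻¹ • d.soul‖ < 1 := by
  rw [norm_smul, norm_inv, Real.norm_eq_abs, inv_mul_eq_div]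
  exact hd.2

/-- The scaling `|β(d)|^(-1/2) (1 + s(d) / β(d))^(-1/2)`. -/
noncomputable def binomialScaling (d : Supernumber) : Supernumber :=
  (√|d.body|)⁻¹ • binomialSum (-1 / 2) (d.body⁻¹ • d.soul)

theorem isBinomialScaling_binomialScaling {d : Supernumber} (hd : SoulBodyRatioLtOne d) :
    IsBinomialScaling d (binomialScaling d) := by
  simp only [IsBinomialScaling, binomialScaling, ← smul_smul]
  exact (hasSum_binomialSum _ (norm_inv_body_smul_soul_lt_one hd)).const_smul _

theorem hasParity_binomialScaling {d : Supernumber} (hd : SoulBodyRatioLtOne d)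
    (h : HasParity 0 d) : HasParity 0 (binomialScaling d) :=
  hasParity_of_hasSum (isBinomialScaling_binomialScaling hd) fun k =>
    HasParity.smul _ (pow_mem (S := EvenPart) (HasParity.smul _ h.soul) k)

/-- With `d = β(d)(1 + μ)` the series factors cancel to `1`, leaving the real number `β(d)/|β(d)|`.
-/
theorem binomialScaling_mul_self_mul {d : Supernumber} (hd : SoulBodyRatioLtOne d) :
    binomialScaling d * binomialScaling d * d = (SignType.sign d.body : ℝ) • 1 := by
  have h0 : 0 < |d.body| := abs_pos.2 hd.1
  have e : d = d.body • (1 + d.body⁻¹ • d.soul) := by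
    rw [smul_add, smul_smul, mul_inv_cancel₀ hd.1, one_smul, body_smul_add_soul]
  calc binomialScaling d * binomialScaling d * d
      = binomialScaling d * binomialScaling d * (d.body • (1 + d.body⁻¹ • d.soul)) := by
        rw [← e]
    _ = ((√|d.body|)⁻¹ * (√|d.body|)⁻¹ * d.body) • (1 : Supernumber) := by
        rw [binomialScaling, smul_mul_smul_comm (√|d.body|)⁻¹ _ (√|d.body|)⁻¹ _,
          smul_mul_smul_comm _ _ d.body,
          binomialSum_neg_half_mul_self_mul (norm_inv_body_smul_soul_lt_one hd)]
    _ = _ := by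
        rw [← mul_inv, Real.mul_self_sqrt h0.le]
        congr 1
        rw [inv_mul_eq_iff_eq_mul₀ h0.ne', mul_comm, sign_mul_abs]

theorem contDiffAt_binomialScaling {d : Supernumber} (hd : SoulBodyRatioLtOne d) :
    ContDiffAt ℝ ∞ binomialScaling d := by
  have hb : ContDiffAt ℝ ∞ body d := contDiff_body.contDiffAt
  have h0 : |d.body| ≠ 0 := (abs_pos.2 hd.1).ne'
  have h1 : ContDiffAt ℝ ∞ (fun z : Supernumber => (√|z.body|)⁻¹) d :=
    ((hb.abs hd.1).sqrt h0).inv (Real.sqrt_ne_zero'.2 (abs_pos.2 hd.1))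
  have h2 : ContDiffAt ℝ ∞ (fun z : Supernumber => z.body⁻¹ • z.soul) d :=
    (hb.inv hd.1).smul contDiff_soul.contDiffAt
  have h3 : ContDiffAt ℝ ∞
      (fun z : Supernumber => binomialSum (-1 / 2) (z.body⁻¹ • z.soul)) d :=
    (contDiffAt_binomialSum _ (norm_inv_body_smul_soul_lt_one hd)).comp d h2
  exact h1.smul h3

theorem isUnit_sign_smul_one {r : ℝ} (hr : r ≠ 0) :
    IsUnit ((SignType.sign r : ℝ) • (1 : Supernumber)) := by
  rcases hr.lt_or_gt with h | h <;> simp [h]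

/-- The product `λ (λ d)` is `±1`, and its two factors commute because `λ` is even; commuting
factors of a unit are units. -/
theorem isUnit_binomialScaling {d : Supernumber} (hd : SoulBodyRatioLtOne d)
    (h : HasParity 0 d) : IsUnit (binomialScaling d) := by
  have hl := hasParity_binomialScaling hd h
  have hu := isUnit_sign_smul_one hd.1
  rw [← binomialScaling_mul_self_mul hd, mul_assoc] at hu
  exact (Commute.isUnit_mul_iff (hl.comm _)).1 hu |>.1

end Supernumber

/-! ### The scaling of a `G^∞` function is `G^∞`. -/

open Supernumber

/-- Implicit differentiation of `h² f = ±1` expresses `Dh` through `Df`, which is `Λ⁰`-linear; this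
avoids differentiating body and soul separately, whose derivatives are not `Λ⁰`-linear. -/
theorem IsGInfty.binomialScaling {E : Type*} [NormedAddCommGroup E] [NormedSpace ℝ E]
    [SMul EvenPart E] {f : E → Supernumber} {s : Set E} (hs : IsOpen s) (hf : IsGInfty f s)
    (hr : ∀ x ∈ s, SoulBodyRatioLtOne (f x)) (he : ∀ x ∈ s, HasParity 0 (f x)) :
    IsGInfty (fun x => Supernumber.binomialScaling (f x)) s where
  contDiffOn x hx :=
    (contDiffAt_binomialScaling (hr x hx)).comp_contDiffWithinAt x (hf.contDiffOn x hx)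
  fderiv_smul x hx a v := by
    set h : E → Supernumber := fun x => Supernumber.binomialScaling (f x) with hh
    have hfd := hf.differentiableAt hs hx
    have hhd : DifferentiableAt ℝ h x :=
      ((contDiffAt_binomialScaling (hr x hx)).differentiableAt (by simp)).comp x hfd
    -- The sign of the body is constant near `x`, hence so is `h² f`.
    have hconst : (fun y => h y * h y * f y) =ᶠ[𝓝 x]
        fun _ => (SignType.sign (f x).body : ℝ) • 1 := by
      have hpos : ∀ᶠ y in 𝓝 x, 0 < (f y).body * (f x).body := by
        have hc : ContinuousAt (fun y => (f y).body * (f x).body) x :=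
          (continuous_body.continuousAt.comp hfd.continuousAt).mul continuousAt_const
        exact hc.eventually (lt_mem_nhds (mul_self_pos.2 (hr x hx).1))
      filter_upwards [hs.mem_nhds hx, hpos] with y hy hy'
      rw [hh, binomialScaling_mul_self_mul (hr y hy)]
      rcases pos_and_pos_or_neg_and_neg_of_mul_pos hy' with h | h <;> simp [h.1, h.2]
    have hder := ((hhd.hasFDerivAt.mul' hhd.hasFDerivAt).mul' hfd.hasFDerivAt).unique
      ((hasFDerivAt_const _ x).congr_of_eventuallyEq hconst)
    have hhe : HasParity 0 (h x) := hasParity_binomialScaling (hr x hx) (he x hx)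
    have hke : HasParity 0 (h x * f x) := (zero_add (0 : ZMod 2)) ▸ hhe.mul (he x hx)
    -- The product rule for `h² f`, with the even and hence central values `h x` and `f x` moved to
    -- the left.
    have key : ∀ w, h x * f x * fderiv ℝ h x w + h x * f x * fderiv ℝ h x w
        = -(h x * h x * fderiv ℝ f x w) := fun w => by
      have h1 := DFunLike.congr_fun hder w
      simp only [add_apply, smul_apply, smul_eq_mul, MulOpposite.smul_eq_mul_unop,
        MulOpposite.unop_op, zero_apply] at h1
      rw [eq_neg_iff_add_eq_zero, add_comm, ← h1, ← hhe.comm (fderiv ℝ h x w), add_mul,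
        mul_assoc (h x) (fderiv ℝ h x w), ← (he x hx).comm (fderiv ℝ h x w), ← mul_assoc]
      rfl
    have hk : IsUnit (h x * f x) := by
      have hu := isUnit_sign_smul_one (hr x hx).1
      rw [← binomialScaling_mul_self_mul (hr x hx), mul_assoc] at hu
      exact ((Commute.isUnit_mul_iff (hhe.comm _)).1 hu).2
    -- By `key` both sides are `-h² a Df(v)`; it remains to cancel the unit `h f` and the factor
    -- `2`.
    have h2 : h x * f x * ((2 : ℝ) • fderiv ℝ h x (a • v))
        = h x * f x * ((2 : ℝ) • ((a : Supernumber) * fderiv ℝ h x v)) := by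
      have hl : h x * f x * ((a : Supernumber) * fderiv ℝ h x v)
          = a * (h x * f x * fderiv ℝ h x v) := by
        rw [← mul_assoc, hke.comm (a : Supernumber), mul_assoc]
      have hr : h x * h x * ((a : Supernumber) * fderiv ℝ f x v)
          = a * (h x * h x * fderiv ℝ f x v) := by
        rw [← mul_assoc, ← HasParity.comm a.2 (h x * h x), mul_assoc]
      rw [two_smul, two_smul, mul_add, mul_add, key, hf.fderiv_smul x hx, hl, ← mul_add, key,
        Subalgebra.smul_def, smul_eq_mul, hr, mul_neg]
    exact smul_right_injective _ (two_ne_zero (α := ℝ)) (hk.mul_left_cancel h2)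

/-! ### Rescaling of vector fields, pure bases and Gram matrices. -/

section Supermanifold

variable {m n : ℕ} {M : Type*} [TopologicalSpace M] [ChartedSpace (SuperSpace m n) M]

theorem IsGInftyOn.mul {f h : M → Supernumber} {U : Set M} (hU : IsOpen U)
    (hf : IsGInftyOn m n f U) (hh : IsGInftyOn m n h U) :
    IsGInftyOn m n (fun q => f q * h q) U := fun φ hφ =>
  IsGInfty.mul (φ.isOpen_inter_preimage_symm hU) (hf φ hφ) (hh φ hφ)

theorem IsGInftyOn.binomialScaling {f : M → Supernumber} {U : Set M} (hU : IsOpen U)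
    (hf : IsGInftyOn m n f U) (hr : ∀ q ∈ U, SoulBodyRatioLtOne (f q))
    (he : ∀ q ∈ U, HasParity 0 (f q)) :
    IsGInftyOn m n (fun q => Supernumber.binomialScaling (f q)) U := fun φ hφ =>
  IsGInfty.binomialScaling (φ.isOpen_inter_preimage_symm hU) (hf φ hφ)
    (fun _ hx => hr _ hx.2) fun _ hx => he _ hx.2

theorem IsGInftyOn.continuousOn {f : M → Supernumber} {U : Set M} (hU : IsOpen U)
    (hf : IsGInftyOn m n f U) : ContinuousOn f U := by
  intro q hq
  set φ := chartAt (SuperSpace m n) q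
  have hsrc : q ∈ φ.source := mem_chart_source _ q
  have hopen := φ.isOpen_inter_preimage_symm hU
  have hmem : φ q ∈ φ.target ∩ φ.symm ⁻¹' U :=
    ⟨φ.map_source hsrc, by rwa [mem_preimage, φ.left_inv hsrc]⟩
  have hc : ContinuousAt (f ∘ φ.symm) (φ q) :=
    (hf φ (chart_mem_atlas _ q)).contDiffOn.continuousOn.continuousAt (hopen.mem_nhds hmem)
  refine ((hc.comp (φ.continuousAt hsrc)).congr ?_).continuousWithinAt
  filter_upwards [φ.open_source.mem_nhds hsrc] with y hy
  simp [φ.left_inv hy]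

namespace SuperTangent

variable {p : M}

theorem apply_smul (a : Supernumber) (X : SuperTangent m n p) (f : M → Supernumber) :
    (a • X).apply f = a * X.apply f := by
  unfold SuperTangent.apply
  split_ifs
  · rfl
  · rw [mul_zero]

/-- An even `a` is central, so it passes the factor `F(p)` in the graded Leibniz rule without a
sign. -/
theorem HasParity.smul {ε : ZMod 2} {a : Supernumber} {X : SuperTangent m n p}
    (hX : X.HasParity ε) (ha : Supernumber.HasParity 0 a) : (a • X).HasParity ε where
  hasParity δ F hF := by
    have h := ha.mul (IsSuperderivation.hasParity hX δ F hF)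
    rwa [zero_add] at h
  map_const F c hF := by
    change a * X.1 F = 0
    rw [IsSuperderivation.map_const hX F c hF, mul_zero]
  leibniz δ F G hF := by
    change a * X.1 (F * G) = a * X.1 F * G.1.value + (-1) ^ (ε.val * δ.val) *
      (F.1.value * (a * X.1 G))
    have hc : a * (-1) ^ (ε.val * δ.val) = (-1) ^ (ε.val * δ.val) * a := ha.comm _
    have hv : a * F.1.value = F.1.value * a := ha.comm _
    rw [IsSuperderivation.leibniz hX δ F G hF, mul_add, ← mul_assoc a (X.1 F),
      ← mul_assoc a, hc, mul_assoc _ a, ← mul_assoc a, hv, mul_assoc _ a]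

end SuperTangent

theorem IsSuperVectorField.mono {X : ∀ q : M, SuperTangent m n q} {U V : Set M}
    (hX : IsSuperVectorField X U) (h : V ⊆ U) : IsSuperVectorField X V :=
  fun W hW => hX W (hW.trans h)

theorem IsSuperVectorField.smul {X : ∀ q : M, SuperTangent m n q} {U : Set M}
    {a : M → Supernumber} (hX : IsSuperVectorField X U) (ha : IsGInftyOn m n a U) :
    IsSuperVectorField (fun q => a q • X q) U := by
  intro V hV hVo f hf
  simp only [SuperTangent.apply_smul]
  exact (ha.mono hV).mul hVo (hX V hV hVo f hf)

theorem IsPureBasis.smul {p : M} {ι κ : Type*} {e : ι → SuperTangent m n p}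
    {f : κ → SuperTangent m n p} (h : IsPureBasis e f) {a : ι → Supernumber}
    (hu : ∀ i, IsUnit (a i)) (ha : ∀ i, HasParity 0 (a i)) :
    IsPureBasis (fun i => a i • e i) f := by
  have hw : Sum.elim (fun i => a i • e i) f
      = (Sum.elim (fun i => (hu i).unit) fun _ => 1 : ι ⊕ κ → Supernumberˣ) • Sum.elim e f := by
    ext1 (i | α)
    · rfl
    · exact (one_smul Supernumberˣ (f α)).symm
  exact
    { even := fun i => (h.even i).smul (ha i)
      odd := h.odd
      linearIndependent := by
        rw [hw]
        exact h.linearIndependent.units_smul _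
      span_eq_top := by
        rw [hw]
        exact Module.Basis.units_smul_span_eq_top h.span_eq_top }

namespace SuperRiemannianMetric

variable (g : SuperRiemannianMetric m n M) {p : M}

/-- The metric is given as linear in the first slot only. Supersymmetry swaps the slots, and no sign
appears because `Y` and `a • Y` are even. -/
theorem smul_right_of_hasParity {ε : ZMod 2} {a : Supernumber} {X Y : SuperTangent m n p}
    (ha : HasParity 0 a) (hX : X.HasParity ε) (hY : Y.HasParity 0) :
    g.toFun p X (a • Y) = a * g.toFun p X Y := by
  rw [g.supersymmetric p ε 0 X _ hX (hY.smul ha), g.smul_left,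
    g.supersymmetric p ε 0 X _ hX hY]
  simp

theorem gram_smul {m' l : ℕ} {e : Fin m' → SuperTangent m n p}
    {f : Fin 2 × Fin l → SuperTangent m n p} (h : IsPureBasis e f) {a d : Fin m' → Supernumber}
    (ha : ∀ i, HasParity 0 (a i)) (hg : g.gram e f = canonicalMatrix l d) :
    g.gram (fun i => a i • e i) f = canonicalMatrix l fun i => a i * a i * d i := by
  have hg' : ∀ s t, g.toFun p (Sum.elim e f s) (Sum.elim e f t) = canonicalMatrix l d s t :=
    fun s t => congrFun (congrFun hg s) t
  ext1 s t
  have hst := hg' s t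
  rcases s with i | α <;> rcases t with j | β <;>
    simp only [gram, canonicalMatrix, Matrix.of_apply, Sum.elim_inl, Sum.elim_inr,
      Matrix.fromBlocks_apply₁₁, Matrix.fromBlocks_apply₁₂, Matrix.fromBlocks_apply₂₁,
      Matrix.fromBlocks_apply₂₂, Matrix.zero_apply] at hst ⊢
  · rw [g.smul_left, g.smul_right_of_hasParity (ha j) (h.even i) (h.even j), hst]
    by_cases hij : i = j
    · subst hij
      simp [mul_assoc]
    · simp [Matrix.diagonal_apply_ne _ hij]
  · rw [g.smul_left, hst, mul_zero]
  · rw [g.smul_right_of_hasParity (ha j) (h.odd α) (h.even j), hst, mul_zero]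
  · exact hst

theorem toFun_eq_of_gram_eq {m' l : ℕ} {e : Fin m' → SuperTangent m n p}
    {f : Fin 2 × Fin l → SuperTangent m n p} {d : Fin m' → Supernumber}
    (hg : g.gram e f = canonicalMatrix l d) (i : Fin m') : g.toFun p (e i) (e i) = d i := by
  have h := congrFun (congrFun hg (Sum.inl i)) (Sum.inl i)
  simpa [gram, canonicalMatrix] using h

theorem hasParity_toFun_self {X : SuperTangent m n p} (hX : X.HasParity 0) :
    HasParity 0 (g.toFun p X X) := by
  simpa using g.even p 0 0 X X hX hX

end SuperRiemannianMetric

end Supermanifold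

/-! ### The main theorem. -/

theorem mainTheorem4 (m n l : ℕ) {M : Type*} [TopologicalSpace M]
    [ChartedSpace (SuperSpace m n) M] [HasGroupoid M (gInftyGroupoid m n)]
    (g : SuperRiemannianMetric m n M)
    (p : M) (U : Set M) (hU : IsOpen U) (hpU : p ∈ U)
    (e : Fin m → ∀ q : M, SuperTangent m n q) (f : Fin 2 × Fin l → ∀ q : M, SuperTangent m n q)
    (hef : IsPureFrameOn e f U)
    (d : Fin m → M → Supernumber) (hd : ∀ q ∈ U, ∀ i, IsUnit (d i q))
    (hΓ : ∀ q ∈ U,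
      g.gram (fun i => e i q) (fun α => f α q) = canonicalMatrix l (fun i => d i q)) :
    -- rescaling to a frame in which `η` has the diagonal entries `±1`
    ((∀ i, SoulBodyRatioLtOne (d i p)) →
      ∃ V ⊆ U, IsOpen V ∧ p ∈ V ∧ ∃ lam : Fin m → M → Supernumber,
        (∀ i, IsGInftyOn m n (lam i) V) ∧
        (∀ q ∈ V, ∀ i, lam i q ∈ Supernumber.EvenPart ∧ SoulBodyRatioLtOne (d i q) ∧
          IsBinomialScaling (d i q) (lam i q)) ∧
        IsPureFrameOn (fun i q => lam i q • e i q) f V ∧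
        ∃ ε : Fin m → Supernumber, (∀ i, ε i = 1 ∨ ε i = -1) ∧
          ∀ q ∈ V, g.gram (fun i => lam i q • e i q) (fun α => f α q) = canonicalMatrix l ε) ∧
    -- the basis can be normalized at `p` so that the diagonal entries have norm one
    (∃ c : Fin m → ℝ, (∀ i, 0 < c i) ∧
      ∃ e' : Fin m → SuperTangent m n p,
        (∀ i, e' i = algebraMap ℝ Supernumber (c i) • e i p) ∧
        IsPureBasis e' (fun α => f α p) ∧
        ∃ d' : Fin m → Supernumber,
          g.gram e' (fun α => f α p) = canonicalMatrix l d' ∧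
          ∀ i, ‖d' i‖ = 1 ∧ (SoulBodyRatioLtOne (d i p) ↔ ‖(d' i).soul‖ < 1 / 2)) ∧
    -- for every normalized basis the condition is that the souls have norm less than `1/2`
    (∀ (e' : Fin m → SuperTangent m n p) (f' : Fin 2 × Fin l → SuperTangent m n p),
      IsPureBasis e' f' → (∀ i, ‖g.toFun p (e' i) (e' i)‖ = 1) →
        ∀ i, (SoulBodyRatioLtOne (g.toFun p (e' i) (e' i)) ↔
          ‖(g.toFun p (e' i) (e' i)).soul‖ < 1 / 2)) := by
  -- Evenness and regularity of `d` are not assumed; they are inherited on `U` from `g(e_i, e_i)`,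
  -- which is used in place of `d` below.
  have hD : ∀ q ∈ U, ∀ i, g.toFun q (e i q) (e i q) = d i q := fun q hq i =>
    SuperRiemannianMetric.toFun_eq_of_gram_eq g (hΓ q hq) i
  have hDe : ∀ q ∈ U, ∀ i, HasParity 0 (g.toFun q (e i q) (e i q)) := fun q hq i =>
    g.hasParity_toFun_self ((hef.isPureBasis q hq).even i)
  have hDs : ∀ i, IsGInftyOn m n (fun q => g.toFun q (e i q) (e i q)) U := fun i =>
    g.smooth U hU _ _ (hef.isSuperVectorField_even i) (hef.isSuperVectorField_even i)
  refine ⟨fun hr => ?_, ?_, fun e' f' _ hn i => soulBodyRatioLtOne_iff_of_norm_eq_one (hn i)⟩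
  · let W : Fin m → Set Supernumber := fun i =>
      {z | SoulBodyRatioLtOne z} ∩ {z | 0 < z.body * (d i p).body}
    have hW : ∀ i, IsOpen (W i) := fun i => isOpen_soulBodyRatioLtOne.inter
      (isOpen_lt continuous_const (continuous_body.mul continuous_const))
    -- The outer `U` covers `m = 0`, where the intersection is everything; the inner one is needed
    -- because continuity is known only on `U`.
    let V : Set M := U ∩ ⋂ i, U ∩ (fun q => g.toFun q (e i q) (e i q)) ⁻¹' W i
    have hVU : V ⊆ U := inter_subset_left
    have hVo : IsOpen V := hU.inter <| isOpen_iInter_of_finite fun i =>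
      ((hDs i).continuousOn hU).isOpen_inter_preimage hU (hW i)
    have hV : ∀ q ∈ V, ∀ i, g.toFun q (e i q) (e i q) ∈ W i := fun q hq i =>
      (mem_iInter.1 hq.2 i).2
    have hpV : p ∈ V := ⟨hpU, mem_iInter.2 fun i => ⟨hpU, by
      rw [mem_preimage, hD p hpU i]
      exact ⟨hr i, mul_self_pos.2 (hr i).1⟩⟩⟩
    let lam : Fin m → M → Supernumber := fun i q => binomialScaling (g.toFun q (e i q) (e i q))
    have hlam : ∀ i, IsGInftyOn m n (lam i) V := fun i =>
      ((hDs i).mono hVU).binomialScaling hVo (fun q hq => (hV q hq i).1)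
        fun q hq => hDe q (hVU hq) i
    have hlame : ∀ q ∈ V, ∀ i, HasParity 0 (lam i q) := fun q hq i =>
      hasParity_binomialScaling (hV q hq i).1 (hDe q (hVU hq) i)
    refine ⟨V, hVU, hVo, hpV, lam, hlam, fun q hq i => ⟨hlame q hq i, ?_, ?_⟩, ?_,
      fun i => (SignType.sign (d i p).body : ℝ) • 1, fun i => ?_, fun q hq => ?_⟩
    · exact hD q (hVU hq) i ▸ (hV q hq i).1
    · exact hD q (hVU hq) i ▸ isBinomialScaling_binomialScaling (hV q hq i).1
    · exact
        { isSuperVectorField_even := fun i =>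
            ((hef.isSuperVectorField_even i).mono hVU).smul (hlam i)
          isSuperVectorField_odd := fun α => (hef.isSuperVectorField_odd α).mono hVU
          isPureBasis := fun q hq => (hef.isPureBasis q (hVU hq)).smul
            (fun i => isUnit_binomialScaling (hV q hq i).1 (hDe q (hVU hq) i)) (hlame q hq) }
    · rcases (hr i).1.lt_or_gt with h | h <;> simp [h]
    · rw [g.gram_smul (hef.isPureBasis q (hVU hq)) (hlame q hq) (hΓ q (hVU hq))]
      congr 1
      funext i
      rw [← hD q (hVU hq) i, binomialScaling_mul_self_mul (hV q hq i).1]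
      have hs : 0 < (g.toFun q (e i q) (e i q)).body * (d i p).body := (hV q hq i).2
      rcases pos_and_pos_or_neg_and_neg_of_mul_pos hs with h | h <;> simp [h.1, h.2]
  · have hB := hef.isPureBasis p hpU
    -- Scaling `e_i` by `c` multiplies `d_i` by `c²`, so `c = ‖d_i‖^(-1/2)` normalizes;
    -- invertibility of `d_i` ensures `‖d_i‖ ≠ 0`.
    have hd0 : ∀ i, 0 < ‖d i p‖ := fun i => norm_pos_iff.2 (hd p hpU i).ne_zero
    have hc : ∀ i, 0 < (√‖d i p‖)⁻¹ := fun i => inv_pos.2 (Real.sqrt_pos.2 (hd0 i))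
    have hae : ∀ i, HasParity 0 (algebraMap ℝ Supernumber (√‖d i p‖)⁻¹) := fun i =>
      hasParity_algebraMap _
    refine ⟨fun i => (√‖d i p‖)⁻¹, hc, _, fun i => rfl,
      hB.smul (fun i => (IsUnit.mk0 _ (hc i).ne').map (algebraMap ℝ Supernumber)) hae,
      _, g.gram_smul hB hae (hΓ p hpU), fun i => ?_⟩
    have he : algebraMap ℝ Supernumber (√‖d i p‖)⁻¹ * algebraMap ℝ Supernumber (√‖d i p‖)⁻¹
        * d i p = ‖d i p‖⁻¹ • d i p := by
      rw [← map_mul, ← mul_inv, Real.mul_self_sqrt (norm_nonneg _), Algebra.smul_def]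
    have hn : ‖‖d i p‖⁻¹ • d i p‖ = 1 := by
      rw [norm_smul, norm_inv, norm_norm, inv_mul_cancel₀ (hd0 i).ne']
    rw [he]
    exact ⟨hn, by rw [← soulBodyRatioLtOne_iff_of_norm_eq_one hn,
      soulBodyRatioLtOne_smul (inv_pos.2 (hd0 i)).ne']⟩
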